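/- Let $q(x_1,\dots,x_k)\,{:\!-}\,S_1(\mathbf y_1),\dots,S_l(\mathbf y_l)$ be a full conjunctive query without self-joins: each $\mathbf y_j$ is a vector of $r_j\ge 1$ distinct variables, and every variable occurs in some atom. A database $I$ over the domain $[n]$ consists of one relation $S_j\subseteq[n]^{r_j}$ per atom, and $q(I)\subseteq[n]^k$ is the natural join of these relations. A fractional edge packing of $q$ is a vector $\mathbf u=(u_1,\dots,u_l)$ with $u_j\ge 0$ and $\sum_{j:\,x_i\in S_j}u_j\le 1$ for every variable $x_i$; put $u=\sum_j u_j$ and assume $u>0$. One-round algorithms on $p$ machines work as follows. Each relation is stored at a location of its own. The location of $S_j$ sends to each machine $c$ a bit string that is an arbitrary function of $S_j$ (and of $c$, $j$); machine $c$ then outputs a set of tuples that is an arbitrary function of the bit strings it received, and the output of the algorithm is the union over all machines. The algorithm may be randomized, with random coins shared by all locations and machines. It must output only answers: for every database in the support of the input distribution (and almost all coins) the output is contained in $q(I)$. If machine $c$ receives $N_c$ bits in total, its cost is $g_c(N_c)=N_c/w_c$, with $w_c>0$. The load of the algorithm (for given coins) is the maximum of $N_c/w_c$ over all machines $c$ and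 all databases in the support of the input distribution. Write $\|\mathbf w\|_u=\bigl(\sum_{c\in[p]}w_c^u\bigr)^{1/u}$. For every $\theta\in(0,1)$ there is a constant $C>0$, depending only on $\theta$, such that the following holds for all $q$, $\mathbf u$, $n$, $m$, $p$, $\mathbf w$ as above. 1. (Matching databases.) Let $n\ge 2$ and $m\le n$, and let $m\le\theta n$ if some atom has arity $1$. Let $\mathcal I$ be the uniform distribution on the databases over $[n]$ in which every relation has exactly $m$ tuples and, for every attribute, contains each value at most once in that attribute. Then every one-round algorithm whose expected number of output tuples, over $I\sim\mathcal I$ and the coins, is at least $E_{I\sim\mathcal I}[|q(I)|]$ has, for almost all coins, load at least $C\,m/\|\mathbf w\|_u$. 2. ($\theta$-dense databases.) Let $m=\lfloor\theta n^{r_j}\rfloor$ for every $j$, and let $\mathcal I^d$ be the uniform distribution on the databases over $[n]$ in which every relation $S_j$ is a set of exactly $m$ of the $n^{r_j}$ possible tuples. Then every one-round algorithm whose expected number of output tuples, over $I\sim\mathcal I^d$ and the coins, is at least $E_{I\sim\mathcal I^d}[|q(I)|]$ has, for almost all coins, load at least $C\,m/\|\mathbf w\|_u$. -/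

import Mathlib

open Finset MeasureTheory
open scoped BigOperators NNReal

/-- A full conjunctive query without self-joins, with `k` variables and `l` atoms. Atom `j` is
`S_j(y_j)`, where `y_j = atom j` is a vector of `arity j ≥ 1` distinct variables (a repeated
variable would be a selection), and every variable occurs in some atom. -/
structure ConjunctiveQuery (k l : ℕ) where
  arity : Fin l → ℕ
  arity_pos : ∀ j, 0 < arity j
  atom : ∀ j, Fin (arity j) ↪ Fin k
  covers : ∀ i, ∃ j s, atom j s = i

/-- A relation of arity `r` over a domain with `n` elements. -/
abbrev Relation (r n : ℕ) : Type := Finset (Fin r → Fin n)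

/-- In a matching relation, every value occurs at most once in every attribute. -/
def Relation.IsMatching {r n : ℕ} (R : Relation r n) : Prop :=
  ∀ s : Fin r, ∀ a ∈ R, ∀ b ∈ R, a s = b s → a = b

namespace ConjunctiveQuery

variable {k l : ℕ} (q : ConjunctiveQuery k l)

/-- A database instance: one relation for every atom. -/
abbrev Database (n : ℕ) : Type := ∀ j : Fin l, Relation (q.arity j) n

/-- The answer `q(I)`: the natural join of the relations of `I`. -/
def eval {n : ℕ} (I : q.Database n) : Finset (Fin k → Fin n) :=
  {a | ∀ j, (fun s => a (q.atom j s)) ∈ I j}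

open Classical in
/-- A fractional edge packing: nonnegative weights on the atoms such that, for every variable, the
weights of the atoms that contain it sum to at most one. -/
def IsFractionalEdgePacking (u : Fin l → ℝ) : Prop :=
  (∀ j, 0 ≤ u j) ∧ ∀ i : Fin k, ∑ j with i ∈ Set.range (q.atom j), u j ≤ 1

open Classical in
/-- The matching databases over a domain of size `n` with `m` tuples in every relation. -/
noncomputable def matchingDatabases (n m : ℕ) : Finset (q.Database n) :=
  {I | ∀ j, (I j).IsMatching ∧ (I j).card = m}

open Classical in
/-- The `θ`-dense databases over a domain of size `n`: each relation has a fraction `θ` of all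
possible tuples (rounded down if that is not a whole number). -/
noncomputable def denseDatabases (θ : ℝ) (n : ℕ) : Finset (q.Database n) :=
  {I | ∀ j, (I j).card = ⌊θ * (n : ℝ) ^ q.arity j⌋₊}

/-- A (deterministic) one-round algorithm on `p` machines. Each relation is stored at a location of
its own; the location of `S_j` sends to machine `c` an arbitrary bit string `msg c j S_j`, and then
machine `c` outputs an arbitrary set of tuples that depends only on the bit strings it received. -/
structure OneRoundAlgorithm (n p : ℕ) where
  msg : Fin p → ∀ j : Fin l, Relation (q.arity j) n → List Bool
  out : Fin p → (Fin l → List Bool) → Finset (Fin k → Fin n)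

namespace OneRoundAlgorithm

variable {q} {n p : ℕ} (A : q.OneRoundAlgorithm n p)

/-- The number of bits that machine `c` receives on input `I`. -/
def bits (I : q.Database n) (c : Fin p) : ℕ := ∑ j, (A.msg c j (I j)).length

/-- The output on input `I`: the union of the outputs of all machines. -/
def output (I : q.Database n) : Finset (Fin k → Fin n) :=
  univ.biUnion fun c => A.out c fun j => A.msg c j (I j)

/-- On the inputs in `D`, the algorithm outputs only answers of the query. -/
def IsSoundOn (D : Finset (q.Database n)) : Prop := ∀ I ∈ D, A.output I ⊆ q.eval I

/-- The load on the inputs in `D` for the cost functions `g`: the largest cost of a machine on an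
input in `D`. -/
noncomputable def load (D : Finset (q.Database n)) (g : Fin p → ℕ → ℝ≥0) : ℝ≥0 :=
  D.sup fun I => univ.sup fun c => g c (A.bits I c)

end OneRoundAlgorithm

end ConjunctiveQuery

/-- The linear cost functions `g_c(N) = N / w_c`. -/
noncomputable def linearCost {p : ℕ} (w : Fin p → ℝ≥0) (c : Fin p) (N : ℕ) : ℝ≥0 := N / w c

/-- `m / ‖w‖_t`, where `‖w‖_t = (∑ c, w_c ^ t) ^ (1 / t)`. -/
noncomputable def lowerLoad {p : ℕ} (m : ℕ) (w : Fin p → ℝ≥0) (t : ℝ) : ℝ≥0 :=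
  m / (∑ c, w c ^ t) ^ (1 / t)

/-!
A randomized algorithm that outputs only answers, and in expectation as many of them as there are,
outputs exactly `q(I)` for almost all coins and all `I`; so it suffices to bound the load of a
deterministic exact algorithm.

Let `F j` be the family of the possible relations `S_j`, and let `L` be the load. A set `T` of
tuples is contained in at most a `β ^ #T` fraction of the members of `F j`, while machine `c`
receives at most `N = L * w_c` bits about `S_j`, that is, one of at most `3 ^ N` messages. Hence,
by Jensen's inequality, the message determines on average only `O(N)` tuples of `S_j`. But the
machine can output an answer only if its messages determine all tuples that the answer projects to.

Fix a tuple `a` and condition on its being an answer, and let `v_cj(a)` be the probability that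
machine `c` knows the projection of `a` to `S_j`. Some machine outputs `a`, so
`1 ≤ ∑ c, ∏ j, v_cj(a) ≤ ∑ c, ∏ j, v_cj(a) ^ u_j`. Averaging over `a`, Finner's inequality for the
fractional packing `u` moves the average inside the product, and the average of `v_cj` is
`O(N) / m` because all tuples lie in equally many members of `F j`. Therefore
`1 ≤ ∑ c, (O(L * w_c) / m) ^ ∑ j, u_j`, which is the claim.
-/

section Finner

open scoped ENNReal

theorem lintegral_prod_rpow_le_of_sum_le_one {α ι : Type*} [MeasurableSpace α] (μ : Measure α)
    [IsProbabilityMeasure μ] (s : Finset ι) {f : ι → α → ℝ≥0∞} (hf : ∀ j ∈ s, AEMeasurable (f j) μ)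
    {u : ι → ℝ} (hu : ∀ j ∈ s, 0 ≤ u j) (hs : ∑ j ∈ s, u j ≤ 1) :
    ∫⁻ x, ∏ j ∈ s, f j x ^ u j ∂μ ≤ ∏ j ∈ s, (∫⁻ x, f j x ∂μ) ^ u j := by
  -- The missing weight is given to the constant function `1`.
  have h := ENNReal.lintegral_prod_norm_pow_le (μ := μ) (insertNone s)
    (f := fun o => o.elim 1 f) (p := fun o => o.elim (1 - ∑ j ∈ s, u j) u)
    (forall_mem_insertNone.2 ⟨aemeasurable_const, hf⟩) (by simp [sum_insertNone])
    (forall_mem_insertNone.2 ⟨sub_nonneg.2 hs, hu⟩)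
  simpa [prod_insertNone] using h

variable {κ ι : Type*} [DecidableEq κ] {X : κ → Type*} [∀ i, MeasurableSpace (X i)]
  (μ : ∀ i, Measure (X i))

lemma lmarginal_update_of_dependsOn (s : Finset κ) {f : (∀ i, X i) → ℝ≥0∞} {A : Set κ}
    (hf : DependsOn f A) {i : κ} (hi : i ∉ A) (x : ∀ i, X i) (y : X i) :
    (∫⋯∫⁻_s, f ∂μ) (Function.update x i y) = (∫⋯∫⁻_s, f ∂μ) x := by
  refine lintegral_congr fun z => hf fun i' hi' => ?_
  have : i' ≠ i := ne_of_mem_of_not_mem hi' hi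
  simp [Function.updateFinset_def, this]

/-- Finner's inequality. Integrating out the coordinates one at a time, each step is Hölder's
inequality for those functions that depend on the coordinate. -/
theorem lmarginal_prod_rpow_le_of_dependsOn [∀ i, IsProbabilityMeasure (μ i)] [Fintype ι]
    {f : ι → (∀ i, X i) → ℝ≥0∞} (hf : ∀ j, Measurable (f j)) {A : ι → Set κ}
    (hA : ∀ j, DependsOn (f j) (A j)) {u : ι → ℝ} (hu : ∀ j, 0 ≤ u j)
    [∀ i, DecidablePred (i ∈ A ·)] (hsum : ∀ i, ∑ j with i ∈ A j, u j ≤ 1) (s : Finset κ)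
    (x : ∀ i, X i) :
    (∫⋯∫⁻_s, fun a => ∏ j, f j a ^ u j ∂μ) x ≤ ∏ j, (∫⋯∫⁻_s, f j ∂μ) x ^ u j := by
  induction s using Finset.induction generalizing x with
  | empty => simp
  | insert i s hi ih =>
    set g : ι → X i → ℝ≥0∞ := fun j y => (∫⋯∫⁻_s, f j ∂μ) (Function.update x i y)
    have hg (j : ι) : Measurable (g j) := ((hf j).lmarginal μ).comp (measurable_update x)
    have hins (j : ι) : (∫⋯∫⁻_insert i s, f j ∂μ) x = ∫⁻ y, g j y ∂μ i :=
      lmarginal_insert _ (hf j) hi x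
    have hconst (j : ι) (hj : i ∉ A j) (y : X i) : g j y = ∫⁻ y, g j y ∂μ i := by
      simp only [g, lmarginal_update_of_dependsOn μ s (hA j) hj, lintegral_const, measure_univ,
        mul_one]
    calc (∫⋯∫⁻_insert i s, fun a => ∏ j, f j a ^ u j ∂μ) x
        = ∫⁻ y, (∫⋯∫⁻_s, fun a => ∏ j, f j a ^ u j ∂μ) (Function.update x i y) ∂μ i :=
          lmarginal_insert _ (Finset.measurable_prod _ fun j _ => (hf j).pow_const _) hi x
      _ ≤ ∫⁻ y, ∏ j, g j y ^ u j ∂μ i := lintegral_mono fun y => ih _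
      _ = (∫⁻ y, ∏ j with i ∈ A j, g j y ^ u j ∂μ i) *
            ∏ j with i ∉ A j, (∫⁻ y, g j y ∂μ i) ^ u j := by
          rw [← lintegral_mul_const _ (Finset.measurable_prod _ fun j _ => (hg j).pow_const _)]
          refine lintegral_congr fun y => ?_
          rw [← prod_filter_mul_prod_filter_not univ (i ∈ A ·)]
          congr 1
          exact prod_congr rfl fun j hj => by rw [← hconst j (mem_filter.1 hj).2]
      _ ≤ (∏ j with i ∈ A j, (∫⁻ y, g j y ∂μ i) ^ u j) *
            ∏ j with i ∉ A j, (∫⁻ y, g j y ∂μ i) ^ u j := by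
          gcongr
          exact lintegral_prod_rpow_le_of_sum_le_one (μ i) _ (fun j _ => (hg j).aemeasurable)
            (fun j _ => hu j) (hsum i)
      _ = ∏ j, (∫⋯∫⁻_insert i s, f j ∂μ) x ^ u j := by
          simp only [hins, prod_filter_mul_prod_filter_not]

end Finner

section Expect

open ProbabilityTheory

lemma ofReal_expect {α : Type*} [Fintype α] [Nonempty α] [MeasurableSpace α]
    [MeasurableSingletonClass α] {f : α → ℝ} (hf : ∀ a, 0 ≤ f a) :
    ENNReal.ofReal (𝔼 a, f a) = ∫⁻ a, ENNReal.ofReal (f a) ∂uniformOn Set.univ := by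
  rw [lintegral_fintype, Fintype.expect_eq_sum_div_card,
    ENNReal.ofReal_div_of_pos (by exact_mod_cast Fintype.card_pos),
    ENNReal.ofReal_sum_of_nonneg fun a _ => hf a]
  simp [uniformOn_univ, div_eq_mul_inv, sum_mul]

theorem expect_prod_rpow_le_of_dependsOn {κ ι X : Type*} [Fintype κ] [DecidableEq κ] [Fintype ι]
    [Fintype X] [Nonempty X] {f : ι → (κ → X) → ℝ} (hf : ∀ j a, 0 ≤ f j a) {A : ι → Set κ}
    (hA : ∀ j, DependsOn (f j) (A j)) {u : ι → ℝ} (hu : ∀ j, 0 ≤ u j)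
    [∀ i, DecidablePred (i ∈ A ·)] (hsum : ∀ i, ∑ j with i ∈ A j, u j ≤ 1) :
    𝔼 a, ∏ j, f j a ^ u j ≤ ∏ j, (𝔼 a, f j a) ^ u j := by
  let _ : MeasurableSpace X := ⊤
  have hmean (j : ι) : 0 ≤ 𝔼 a, f j a := expect_nonneg fun a _ => hf j a
  have hpow (j : ι) (a : κ → X) : 0 ≤ f j a ^ u j := Real.rpow_nonneg (hf j a) _
  have hmean_pow (j : ι) : 0 ≤ (𝔼 a, f j a) ^ u j := Real.rpow_nonneg (hmean j) _
  have hunif : uniformOn (Set.univ : Set (κ → X)) = Measure.pi fun _ => uniformOn Set.univ := by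
    rw [← uniformOn_pi, Set.pi_univ]
  have h := lmarginal_prod_rpow_le_of_dependsOn (fun _ => uniformOn (Set.univ : Set X))
    (f := fun j a => ENNReal.ofReal (f j a)) (fun j => measurable_of_finite _)
    (fun j a b hab => congrArg ENNReal.ofReal (hA j hab)) hu hsum univ
    (fun _ => Classical.arbitrary X)
  simp_rw [lmarginal_univ, ← hunif, ← ofReal_expect (hf _),
    ENNReal.ofReal_rpow_of_nonneg (hf _ _) (hu _),
    ENNReal.ofReal_rpow_of_nonneg (hmean _) (hu _),
    ← ENNReal.ofReal_prod_of_nonneg fun j _ => hpow j _,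
    ← ENNReal.ofReal_prod_of_nonneg fun j _ => hmean_pow j] at h
  rw [← ofReal_expect fun a => prod_nonneg fun j _ => hpow j a] at h
  exact (ENNReal.ofReal_le_ofReal_iff (prod_nonneg fun j _ => hmean_pow j)).1 h

lemma expect_comp_embedding {α β X : Type*} [Fintype α] [Fintype β] [DecidableEq α]
    [DecidableEq β] [Fintype X] [Nonempty X] (e : β ↪ α) (g : (β → X) → ℝ) :
    𝔼 a : α → X, g (a ∘ e) = 𝔼 b, g b := by
  classical
  let E : (α → X) ≃ (β → X) × ({i // i ∉ Set.range e} → X) :=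
    (Equiv.piEquivPiSubtypeProd (· ∈ Set.range e) fun _ => X).trans
      (((Equiv.ofInjective e e.injective).symm.arrowCongr (Equiv.refl X)).prodCongr
        (Equiv.refl _))
  calc 𝔼 a : α → X, g (a ∘ e)
      = 𝔼 z : (β → X) × ({i // i ∉ Set.range e} → X), g z.1 :=
        Fintype.expect_equiv E _ _ fun _ => rfl
    _ = 𝔼 b, g b := by
      rw [← univ_product_univ, expect_product]
      exact expect_congr rfl fun b _ => expect_const univ_nonempty (g b)

lemma expect_piFinset_prod {ι : Type*} [Fintype ι] [DecidableEq ι] {κ : ι → Type*}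
    (F : ∀ j, Finset (κ j)) (h : ∀ j, κ j → ℝ) :
    𝔼 I ∈ Fintype.piFinset F, ∏ j, h j (I j) = ∏ j, 𝔼 S ∈ F j, h j S := by
  simp_rw [expect_eq_sum_div_card, prod_div_distrib, prod_univ_sum, Fintype.card_piFinset,
    Nat.cast_prod]

end Expect

section Spread

lemma exp_expect_le_expect_exp {ι : Type*} {s : Finset ι} (hs : s.Nonempty) (x : ι → ℝ) :
    Real.exp (𝔼 i ∈ s, x i) ≤ 𝔼 i ∈ s, Real.exp (x i) := by
  have hcard : (#s : ℝ) ≠ 0 := by exact_mod_cast hs.card_ne_zero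
  simpa [← mul_sum, expect_eq_sum_div_card, div_eq_inv_mul] using
    convexOn_exp.map_sum_le (t := s) (w := fun _ => (#s : ℝ)⁻¹) (p := x)
      (fun _ _ => by positivity) (by simp [hcard]) fun _ _ => Set.mem_univ _

lemma card_le_pow_of_length_le {B : Type*} [Fintype B] {s : Finset (List B)} {N : ℕ}
    (hs : ∀ x ∈ s, x.length ≤ N) : #s ≤ (Fintype.card B + 1) ^ N := by
  classical
  have hinj : Set.InjOn (fun (x : List B) (i : Fin N) => x[i.val]?) s := by
    intro x hx y hy hxy
    refine List.ext_getElem? fun i => ?_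
    rcases lt_or_ge i N with hi | hi
    · exact congrFun hxy ⟨i, hi⟩
    · rw [List.getElem?_eq_none ((hs x hx).trans hi), List.getElem?_eq_none ((hs y hy).trans hi)]
  simpa using card_le_card_of_injOn (t := univ) _ (fun _ _ => mem_univ _) hinj

variable {α M : Type*} [DecidableEq α]

/-- A family `F` of finite sets is `β`-spread if a uniformly random member of `F` contains any given
`t` elements with probability at most `β ^ t`. -/
def IsSpread (F : Finset (Finset α)) (β : ℝ) : Prop :=
  ∀ T : Finset α, (#{S ∈ F | T ⊆ S} : ℝ) ≤ β ^ #T * #F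

lemma IsSpread.mono {F : Finset (Finset α)} {β γ : ℝ} (h : IsSpread F β) (hβ : 0 ≤ β)
    (hβγ : β ≤ γ) : IsSpread F γ :=
  fun T => (h T).trans (by gcongr)

variable [Fintype α] [DecidableEq M]

/-- What the value `v` of `f` tells about an unknown member of the family `F`: the elements that lie
in every `S ∈ F` with `f S = v`. -/
def revealed (F : Finset (Finset α)) (f : Finset α → M) (v : M) : Finset α :=
  {a | ∀ S ∈ F, f S = v → a ∈ S}

variable {F : Finset (Finset α)} {f : Finset α → M}

lemma mem_revealed {v : M} {a : α} : a ∈ revealed F f v ↔ ∀ S ∈ F, f S = v → a ∈ S := by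
  simp [revealed]

lemma revealed_subset {S : Finset α} (hS : S ∈ F) : revealed F f (f S) ⊆ S :=
  fun _ ha => mem_revealed.1 ha S hS rfl

lemma IsSpread.expect_inv_pow_card_revealed_le {β : ℝ} (h : IsSpread F β) (hβ : 0 < β)
    (f : Finset α → M) : 𝔼 S ∈ F, β⁻¹ ^ #(revealed F f (f S)) ≤ #(F.image f) := by
  rw [expect_eq_sum_div_card]
  refine div_le_of_le_mul₀ (by positivity) (by positivity) ?_
  rw [sum_comp (fun v => β⁻¹ ^ #(revealed F f v)) f, ← nsmul_eq_mul, ← sum_const]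
  refine sum_le_sum fun v _ => ?_
  have hfibre : {S ∈ F | f S = v} ⊆ {S ∈ F | revealed F f v ⊆ S} := by
    intro S hS
    obtain ⟨hSF, rfl⟩ := mem_filter.1 hS
    exact mem_filter.2 ⟨hSF, revealed_subset hSF⟩
  rw [nsmul_eq_mul, inv_pow, ← div_eq_mul_inv, div_le_iff₀' (by positivity)]
  exact (Nat.cast_le.2 (card_le_card hfibre)).trans (h _)

theorem IsSpread.expect_card_revealed_mul_log_le {β : ℝ} (h : IsSpread F β) (hβ : 0 < β)
    (hF : F.Nonempty) (f : Finset α → M) :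
    (𝔼 S ∈ F, (#(revealed F f (f S)) : ℝ)) * Real.log β⁻¹ ≤ Real.log #(F.image f) := by
  rw [Real.le_log_iff_exp_le (by exact_mod_cast (hF.image f).card_pos), expect_mul]
  refine (exp_expect_le_expect_exp hF _).trans ?_
  simpa only [← Real.log_pow, Real.exp_log (pow_pos (inv_pos.2 hβ) _)] using
    h.expect_inv_pow_card_revealed_le hβ f

theorem IsSpread.logb_mul_expect_card_revealed_le {B : Type*} [Fintype B] [Nonempty B]
    [DecidableEq B] {β : ℝ} (h : IsSpread F β) (hβ : 0 < β) (hF : F.Nonempty)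
    {f : Finset α → List B} {N : ℕ} (hN : ∀ S ∈ F, (f S).length ≤ N) :
    Real.logb (Fintype.card B + 1) β⁻¹ * 𝔼 S ∈ F, (#(revealed F f (f S)) : ℝ) ≤ N := by
  have hlog : 0 < Real.log (Fintype.card B + 1) :=
    Real.log_pos (by exact_mod_cast Nat.lt_add_of_pos_left Fintype.card_pos)
  have hstrings : (#(F.image f) : ℝ) ≤ (Fintype.card B + 1) ^ N := by
    exact_mod_cast card_le_pow_of_length_le (by simpa using hN)
  rw [Real.logb, div_mul_eq_mul_div, div_le_iff₀ hlog, ← Real.log_pow, mul_comm]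
  exact (h.expect_card_revealed_mul_log_le hβ hF f).trans
    (Real.log_le_log (by exact_mod_cast (hF.image f).card_pos) hstrings)

end Spread

section OneDesign

open scoped Pointwise

variable {α : Type*} [DecidableEq α]

/-- A 1-design with block size `m`: a family of `m`-element sets such that every point lies in
equally many of them. -/
structure IsOneDesign (F : Finset (Finset α)) (m : ℕ) : Prop where
  card_eq : ∀ S ∈ F, #S = m
  card_filter_mem_eq : ∀ a b, #{S ∈ F | a ∈ S} = #{S ∈ F | b ∈ S}

lemma isOneDesign_of_smul_mem (G : Type*) [Group G] [MulAction G α] [MulAction.IsPretransitive G α]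
    {F : Finset (Finset α)} {m : ℕ} (hcard : ∀ S ∈ F, #S = m)
    (hG : ∀ (g : G), ∀ S ∈ F, g • S ∈ F) : IsOneDesign F m := by
  have hle (a b : α) : #{S ∈ F | a ∈ S} ≤ #{S ∈ F | b ∈ S} := by
    obtain ⟨g, rfl⟩ := MulAction.exists_smul_eq G a b
    refine card_le_card_of_injOn (g • ·) (fun S hS => ?_) (MulAction.injective g).injOn
    obtain ⟨hSF, haS⟩ := mem_filter.1 hS
    exact mem_filter.2 ⟨hG g S hSF, smul_mem_smul_finset haS⟩
  exact ⟨hcard, fun a b => (hle a b).antisymm (hle b a)⟩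

lemma IsOneDesign.filter_mem_nonempty {F : Finset (Finset α)} {m : ℕ} (h : IsOneDesign F m)
    (hF : F.Nonempty) (hm : 0 < m) (a : α) : ({S ∈ F | a ∈ S}).Nonempty := by
  obtain ⟨S, hS⟩ := hF
  obtain ⟨b, hb⟩ := card_pos.1 (hm.trans_eq (h.card_eq S hS).symm)
  rw [← card_pos, h.card_filter_mem_eq a b]
  exact card_pos.2 ⟨S, mem_filter.2 ⟨hS, hb⟩⟩

variable [Fintype α]

lemma isOneDesign_powersetCard (m : ℕ) : IsOneDesign (powersetCard m (univ : Finset α)) m :=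
  isOneDesign_of_smul_mem (Equiv.Perm α) (fun _ hS => (mem_powersetCard_univ.1 hS)) fun g S hS => by
    simpa [mem_powersetCard_univ, card_smul_finset] using hS

variable {F : Finset (Finset α)} {m : ℕ}

lemma IsOneDesign.card_filter_mem_mul_card (h : IsOneDesign F m) (a : α) :
    #{S ∈ F | a ∈ S} * Fintype.card α = m * #F := by
  have := sum_card (B := F) fun b => h.card_filter_mem_eq b a
  rwa [sum_congr rfl h.card_eq, sum_const, smul_eq_mul, mul_comm, eq_comm, mul_comm] at this

variable {M : Type*} [DecidableEq M]

/-- The probability that `f S` reveals the element `a` of the random member `S` of the family `F`,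
conditioned on `a ∈ S`. -/
noncomputable def revealProb (F : Finset (Finset α)) (f : Finset α → M) (a : α) : ℝ :=
  𝔼 S ∈ F with a ∈ S, if a ∈ revealed F f (f S) then 1 else 0

lemma revealProb_nonneg (F : Finset (Finset α)) (f : Finset α → M) (a : α) : 0 ≤ revealProb F f a :=
  expect_nonneg fun _ _ => by positivity

lemma revealProb_le_one (F : Finset (Finset α)) (f : Finset α → M) (a : α) :
    revealProb F f a ≤ 1 := by
  rw [revealProb, expect_eq_sum_div_card, sum_boole]
  exact div_le_one_of_le₀ (Nat.cast_le.2 (card_filter_le _ _)) (Nat.cast_nonneg _)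

lemma IsOneDesign.expect_revealProb (h : IsOneDesign F m) (f : Finset α → M) :
    𝔼 a, revealProb F f a = (𝔼 S ∈ F, (#(revealed F f (f S)) : ℝ)) / m := by
  have hterm (a : α) : revealProb F f a / Fintype.card α =
      (∑ S ∈ F, if a ∈ revealed F f (f S) then (1 : ℝ) else 0) / (m * #F) := by
    have hsum : ∑ S ∈ F with a ∈ S, (if a ∈ revealed F f (f S) then (1 : ℝ) else 0) =
        ∑ S ∈ F, if a ∈ revealed F f (f S) then (1 : ℝ) else 0 :=
      sum_filter_of_ne fun S hS hne => revealed_subset hS (of_not_not fun ha => hne (if_neg ha))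
    have hcount : (#{S ∈ F | a ∈ S} : ℝ) * Fintype.card α = m * #F := by
      exact_mod_cast h.card_filter_mem_mul_card a
    rw [revealProb, expect_eq_sum_div_card, hsum, div_div, hcount]
  rw [Fintype.expect_eq_sum_div_card, sum_div, expect_eq_sum_div_card, div_div, mul_comm (#F : ℝ)]
  simp_rw [hterm, ← sum_div]
  rw [sum_comm]
  simp

end OneDesign

section SpreadPowersetCard

lemma descFactorial_le_pow_mul_descFactorial {θ : ℝ} (hθ₀ : 0 ≤ θ) (hθ₁ : θ ≤ 1) {M N : ℕ}
    (h : (M : ℝ) ≤ θ * N) (t : ℕ) : (M.descFactorial t : ℝ) ≤ θ ^ t * N.descFactorial t := by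
  induction t with
  | zero => simp
  | succ t ih =>
    have hfactor : ((M - t : ℕ) : ℝ) ≤ θ * (N - t : ℕ) := by
      rcases le_total M t with hMt | htM
      · rw [Nat.sub_eq_zero_of_le hMt, Nat.cast_zero]
        positivity
      · have hMN : M ≤ N := by
          exact_mod_cast h.trans (mul_le_of_le_one_left (Nat.cast_nonneg N) hθ₁)
        rw [Nat.cast_sub htM, Nat.cast_sub (htM.trans hMN), mul_sub]
        exact sub_le_sub h (mul_le_of_le_one_left (Nat.cast_nonneg t) hθ₁)
    simp only [Nat.descFactorial_succ, Nat.cast_mul]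
    calc ((M - t : ℕ) : ℝ) * M.descFactorial t
        ≤ (θ * (N - t : ℕ)) * (θ ^ t * N.descFactorial t) := by gcongr
      _ = θ ^ (t + 1) * ((N - t : ℕ) * N.descFactorial t) := by ring

theorem isSpread_powersetCard {α : Type*} [Fintype α] [DecidableEq α] {θ : ℝ} (hθ₀ : 0 ≤ θ)
    (hθ₁ : θ ≤ 1) {m : ℕ} (hm : (m : ℝ) ≤ θ * Fintype.card α) :
    IsSpread (powersetCard m (univ : Finset α)) θ := by
  intro T
  set N := Fintype.card α
  have hmN : m ≤ N := by
    exact_mod_cast hm.trans (mul_le_of_le_one_left (Nat.cast_nonneg N) hθ₁)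
  rcases le_or_gt #T m with hT | hT
  · have hcount : N.descFactorial #T * (N - #T).choose (m - #T) =
        m.descFactorial #T * N.choose m := by
      rw [Nat.descFactorial_eq_factorial_mul_choose, Nat.descFactorial_eq_factorial_mul_choose,
        mul_assoc, mul_assoc, ← Nat.choose_mul hT, mul_comm (N.choose m)]
    rw [card_filter_powersetCard_subset T univ m (subset_univ T) hT, card_powersetCard, card_univ]
    have hpos : (0 : ℝ) < N.descFactorial #T := by
      exact_mod_cast Nat.descFactorial_pos.2 (hT.trans hmN)
    refine le_of_mul_le_mul_left ?_ hpos
    calc (N.descFactorial #T : ℝ) * (N - #T).choose (m - #T)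
        = m.descFactorial #T * N.choose m := by exact_mod_cast hcount
      _ ≤ (θ ^ #T * N.descFactorial #T) * N.choose m := by
          gcongr
          exact descFactorial_le_pow_mul_descFactorial hθ₀ hθ₁ hm #T
      _ = N.descFactorial #T * (θ ^ #T * N.choose m) := by ring
  · rw [filter_eq_empty_iff.2 fun S hS hTS =>
      hT.not_ge ((card_le_card hTS).trans (mem_powersetCard_univ.1 hS).le), card_empty,
      Nat.cast_zero]
    positivity

end SpreadPowersetCard

section Matchings

open scoped Pointwise

open Classical in
/-- The matching relations with `m` tuples, the possible values of a relation in a matching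
database. -/
noncomputable def matchings (r n m : ℕ) : Finset (Relation r n) := {R | R.IsMatching ∧ #R = m}

variable {r n m : ℕ} {R R' : Relation r n}

lemma mem_matchings : R ∈ matchings r n m ↔ R.IsMatching ∧ #R = m := by
  simp [matchings]

lemma isMatching_smul (hR : R.IsMatching) (σ : Fin r → Equiv.Perm (Fin n)) :
    Relation.IsMatching (σ • R) := by
  intro s a ha b hb hab
  obtain ⟨a, ha', rfl⟩ := mem_smul_finset.1 ha
  obtain ⟨b, hb', rfl⟩ := mem_smul_finset.1 hb
  rw [hR s a ha' b hb' ((σ s).injective hab)]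

lemma smul_mem_matchings (hR : R ∈ matchings r n m) (σ : Fin r → Equiv.Perm (Fin n)) :
    σ • R ∈ matchings r n m := by
  rw [mem_matchings] at hR ⊢
  exact ⟨isMatching_smul hR.1 σ, (card_smul_finset σ R).trans hR.2⟩

lemma isPretransitive_pi_perm (ι : Type*) (X : ι → Type*) :
    MulAction.IsPretransitive (∀ i, Equiv.Perm (X i)) (∀ i, X i) where
  exists_smul_eq a b := by
    choose σ hσ using fun i => MulAction.exists_smul_eq (Equiv.Perm (X i)) (a i) (b i)
    exact ⟨σ, funext hσ⟩

lemma isOneDesign_matchings (r n m : ℕ) : IsOneDesign (matchings r n m) m :=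
  have := isPretransitive_pi_perm (Fin r) fun _ => Fin n
  isOneDesign_of_smul_mem (Fin r → Equiv.Perm (Fin n)) (fun _ hR => (mem_matchings.1 hR).2)
    fun σ _ hR => smul_mem_matchings hR σ

lemma matchings_nonempty (hr : 0 < r) (hm : m ≤ n) : (matchings r n m).Nonempty := by
  have hdiag : Function.Injective fun (i : Fin m) (_ : Fin r) => Fin.castLE hm i :=
    fun i j hij => Fin.castLE_injective hm (congrFun hij ⟨0, hr⟩)
  refine ⟨univ.map ⟨_, hdiag⟩, mem_matchings.2 ⟨?_, by simp⟩⟩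
  intro s a ha b hb hab
  obtain ⟨i, -, rfl⟩ := mem_map.1 ha
  obtain ⟨j, -, rfl⟩ := mem_map.1 hb
  rw [Fin.castLE_injective hm hab]

lemma matchings_one (n m : ℕ) : matchings 1 n m = powersetCard m univ := by
  ext R
  simp only [mem_matchings, mem_powersetCard_univ, and_iff_right_iff_imp]
  intro _ s a _ b _ hab
  exact funext fun t => Subsingleton.elim s t ▸ hab

lemma injOn_apply_of_isMatching (hR : R.IsMatching) (s : Fin r) :
    Set.InjOn (· s) (R : Set (Fin r → Fin n)) :=
  fun a ha b hb hab => hR s a ha b hb hab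

lemma card_le_of_isMatching (hR : R.IsMatching) (hr : 0 < r) : #R ≤ n := by
  simpa using card_le_card_of_injOn (t := univ) _ (fun _ _ => mem_univ _)
    (injOn_apply_of_isMatching hR ⟨0, hr⟩)

lemma apply_eq_of_update_smul_eq_update_smul (hR : R.IsMatching) {s s' : Fin r} (hs : s' ≠ s)
    {π π' : Equiv.Perm (Fin n)}
    (h : Function.update (1 : Fin r → Equiv.Perm (Fin n)) s π • R =
      Function.update (1 : Fin r → Equiv.Perm (Fin n)) s π' • R')
    {a : Fin r → Fin n} (ha : a ∈ R) (ha' : a ∈ R') : π (a s) = π' (a s) := by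
  set σ := Function.update (1 : Fin r → Equiv.Perm (Fin n)) s π with hσ
  set σ' := Function.update (1 : Fin r → Equiv.Perm (Fin n)) s π' with hσ'
  have hmem : σ • a ∈ σ • R := smul_mem_smul_finset ha
  have hmem' : σ' • a ∈ σ • R := h ▸ smul_mem_smul_finset ha'
  have hsmul : σ • a = σ' • a :=
    isMatching_smul hR σ s' _ hmem _ hmem' (by simp [hσ, hσ', hs])
  simpa [hσ, hσ'] using congrFun hsmul s

/-- A matching that contains `T` yields `n.descFactorial #T` different matchings: its first
attribute can be permuted so that the tuples in `T` get any given distinct values there, and these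
values can be read off with the help of the second attribute. -/
lemma descFactorial_mul_card_filter_subset_le (hr : 2 ≤ r) (T : Relation r n) :
    n.descFactorial #T * #{R ∈ matchings r n m | T ⊆ R} ≤ #(matchings r n m) := by
  rcases ({R ∈ matchings r n m | T ⊆ R}).eq_empty_or_nonempty with h | ⟨R₀, hR₀⟩
  · simp [h]
  let s : Fin r := ⟨0, by omega⟩
  let s' : Fin r := ⟨1, by omega⟩
  have hs : s' ≠ s := by simp [s, s']
  have hT : Function.Injective fun a : T => (a : Fin r → Fin n) s := by
    obtain ⟨hR₀, hTR₀⟩ := mem_filter.1 hR₀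
    exact ((injOn_apply_of_isMatching (mem_matchings.1 hR₀).1 s).mono hTR₀).injective
  choose π hπ using fun e : T ↪ Fin n => Equiv.Perm.exists_extending_pair _ e hT e.injective
  have hcard : #(univ : Finset (T ↪ Fin n)) = n.descFactorial #T := by
    simp [Fintype.card_embedding_eq]
  rw [← hcard, ← card_product]
  refine card_le_card_of_injOn
    (fun z => Function.update (1 : Fin r → Equiv.Perm (Fin n)) s (π z.1) • z.2) (fun z hz => ?_) ?_
  · exact smul_mem_matchings (mem_filter.1 (mem_product.1 hz).2).1 _
  · rintro ⟨e, R⟩ hR ⟨e', R'⟩ hR' heq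
    obtain ⟨hR, hTR⟩ := mem_filter.1 (mem_product.1 hR).2
    obtain ⟨-, hTR'⟩ := mem_filter.1 (mem_product.1 hR').2
    obtain rfl : e = e' := by
      ext a : 1
      simpa only [hπ] using apply_eq_of_update_smul_eq_update_smul (mem_matchings.1 hR).1 hs heq
        (hTR a.2) (hTR' a.2)
    exact Prod.ext rfl (MulAction.injective _ heq)

lemma two_pow_le_descFactorial {n t : ℕ} (h : t < n) : 2 ^ t ≤ n.descFactorial t := by
  induction t with
  | zero => simp
  | succ t ih =>
    rw [pow_succ, Nat.descFactorial_succ, mul_comm]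
    exact Nat.mul_le_mul (by omega) (ih (by omega))

lemma four_thirds_pow_le_descFactorial {n t : ℕ} (hn : 2 ≤ n) (h : t ≤ n) :
    (4 / 3 : ℝ) ^ t ≤ n.descFactorial t := by
  rcases h.lt_or_eq with h | rfl
  · calc (4 / 3 : ℝ) ^ t ≤ 2 ^ t := by gcongr; norm_num
      _ ≤ n.descFactorial t := by exact_mod_cast two_pow_le_descFactorial h
  · obtain ⟨s, rfl⟩ : ∃ s, t = s + 2 := ⟨t - 2, by omega⟩
    calc (4 / 3 : ℝ) ^ (s + 2) = 16 / 9 * (4 / 3) ^ s := by ring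
      _ ≤ 2 * 2 ^ s := by gcongr <;> norm_num
      _ = 2 ^ (s + 1) := by ring
      _ ≤ (s + 2).descFactorial (s + 1) := by
          exact_mod_cast two_pow_le_descFactorial (by omega)
      _ = (s + 2).descFactorial (s + 2) := by
          rw [Nat.descFactorial_succ _ (s + 1), show s + 2 - (s + 1) = 1 by omega, one_mul]

theorem isSpread_matchings (hr : 2 ≤ r) (hn : 2 ≤ n) (m : ℕ) :
    IsSpread (matchings r n m) (3 / 4) := by
  intro T
  rcases ({R ∈ matchings r n m | T ⊆ R}).eq_empty_or_nonempty with h | ⟨R, hR⟩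
  · rw [h, card_empty, Nat.cast_zero]
    positivity
  obtain ⟨hR, hTR⟩ := mem_filter.1 hR
  have hT : #T ≤ n :=
    (card_le_card hTR).trans (card_le_of_isMatching (mem_matchings.1 hR).1 (by omega))
  rw [show (3 / 4 : ℝ) = (4 / 3)⁻¹ by norm_num, inv_pow, le_inv_mul_iff₀ (by positivity)]
  calc (4 / 3 : ℝ) ^ #T * #{R ∈ matchings r n m | T ⊆ R}
      ≤ n.descFactorial #T * #{R ∈ matchings r n m | T ⊆ R} := by
        gcongr
        exact four_thirds_pow_le_descFactorial hn hT
    _ ≤ #(matchings r n m) := by exact_mod_cast descFactorial_mul_card_filter_subset_le hr T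

theorem isSpread_matchings_max (hr : 0 < r) (hn : 2 ≤ n) {θ : ℝ} (hθ₀ : 0 ≤ θ)
    (hθ₁ : θ ≤ 1) (hm : r = 1 → (m : ℝ) ≤ θ * n) : IsSpread (matchings r n m) (max θ (3 / 4)) := by
  rcases (Nat.succ_le_of_lt hr).eq_or_lt with rfl | hr
  · rw [matchings_one]
    exact (isSpread_powersetCard hθ₀ hθ₁ (by simpa using hm rfl)).mono hθ₀ (le_max_left ..)
  · exact (isSpread_matchings hr hn m).mono (by norm_num) (le_max_right ..)

end Matchings

lemma mul_lowerLoad_le {p m : ℕ} {w : Fin p → ℝ≥0} {t : ℝ} (ht : 0 < t) {C L : ℝ≥0}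
    (h : C ^ t ≤ ∑ c, (L * w c / m) ^ t) : C * lowerLoad m w t ≤ L := by
  set W := (∑ c, w c ^ t) ^ (1 / t) with hW
  have hCW : C ≤ L / m * W := by
    have hsum : ∑ c, (L * w c / m) ^ t = (L / m * W) ^ t := by
      rw [hW, NNReal.mul_rpow, ← NNReal.rpow_mul, one_div_mul_cancel ht.ne', NNReal.rpow_one,
        mul_sum]
      exact sum_congr rfl fun c _ => by rw [← NNReal.mul_rpow, div_mul_eq_mul_div]
    exact (NNReal.rpow_le_rpow_iff ht).1 (h.trans_eq hsum)
  calc C * (m / W) ≤ L / m * W * (m / W) := by gcongr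
    _ = L * ((m / m) * (W / W)) := by ring
    _ ≤ L * (1 * 1) := by gcongr <;> exact div_self_le_one _
    _ = L := by ring

lemma mul_lowerLoad_le_of_one_le_sum_prod {ι : Type*} [Fintype ι] {p m : ℕ} {w : Fin p → ℝ≥0}
    {u : ι → ℝ} (hu : ∀ j, 0 ≤ u j) (hu₀ : 0 < ∑ j, u j) {K : Fin p → ι → ℝ}
    (hK : ∀ c j, 0 ≤ K c j) (hone : 1 ≤ ∑ c, ∏ j, (K c j / m) ^ u j) {C L : ℝ≥0}
    (hCL : ∀ c j, C * K c j ≤ L * w c) : C * lowerLoad m w (∑ j, u j) ≤ L := by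
  have hfactor (c : Fin p) :
      (C : ℝ) ^ (∑ j, u j) * ∏ j, (K c j / m) ^ u j = ∏ j, (C * K c j / m) ^ u j := by
    rw [Real.rpow_sum_of_nonneg C.coe_nonneg fun j _ => hu j, ← prod_mul_distrib]
    refine prod_congr rfl fun j _ => ?_
    rw [mul_div_assoc, Real.mul_rpow C.coe_nonneg (div_nonneg (hK c j) m.cast_nonneg)]
  have hterm (c : Fin p) : ∏ j, (C * K c j / m) ^ u j ≤ (L * w c / m : ℝ) ^ ∑ j, u j := by
    have hCK (j : ι) : 0 ≤ C * K c j := mul_nonneg C.coe_nonneg (hK c j)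
    rw [Real.rpow_sum_of_nonneg (by positivity) fun j _ => hu j]
    refine prod_le_prod (fun j _ => Real.rpow_nonneg (div_nonneg (hCK j) m.cast_nonneg) _)
      fun j _ => Real.rpow_le_rpow (div_nonneg (hCK j) m.cast_nonneg) ?_ (hu j)
    exact div_le_div_of_nonneg_right (hCL c j) m.cast_nonneg
  refine mul_lowerLoad_le hu₀ (NNReal.coe_le_coe.1 ?_)
  push_cast
  calc (C : ℝ) ^ ∑ j, u j ≤ C ^ (∑ j, u j) * ∑ c, ∏ j, (K c j / m) ^ u j :=
        le_mul_of_one_le_right (by positivity) hone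
    _ = ∑ c, ∏ j, (C * K c j / m) ^ u j := by simp only [mul_sum, hfactor]
    _ ≤ ∑ c, (L * w c / m : ℝ) ^ ∑ j, u j := sum_le_sum fun c _ => hterm c

namespace ConjunctiveQuery

variable {k l : ℕ} {q : ConjunctiveQuery k l} {n p m : ℕ}

lemma mem_eval {I : q.Database n} {a : Fin k → Fin n} :
    a ∈ q.eval I ↔ ∀ j, a ∘ q.atom j ∈ I j := by
  simp [eval, Function.comp_def]

lemma IsFractionalEdgePacking.le_one {u : Fin l → ℝ} (hu : q.IsFractionalEdgePacking u)
    (j : Fin l) : u j ≤ 1 :=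
  (single_le_sum (f := u) (fun i _ => hu.1 i)
    (mem_filter.2 ⟨mem_univ j, Set.mem_range_self _⟩)).trans (hu.2 (q.atom j ⟨0, q.arity_pos j⟩))

lemma IsFractionalEdgePacking.expect_prod_rpow_le [NeZero n] {u : Fin l → ℝ}
    (hu : q.IsFractionalEdgePacking u) {v : ∀ j, (Fin (q.arity j) → Fin n) → ℝ}
    (hv : ∀ j b, 0 ≤ v j b) :
    𝔼 a : Fin k → Fin n, ∏ j, v j (a ∘ q.atom j) ^ u j ≤ ∏ j, (𝔼 b, v j b) ^ u j := by
  classical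
  simp_rw [← expect_comp_embedding (q.atom _) (v _)]
  refine expect_prod_rpow_le_of_dependsOn (fun j a => hv j _) (A := fun j => Set.range (q.atom j))
    (fun j a b hab => ?_) hu.1 fun i => ?_
  · exact congrArg (v j) (funext fun s => hab _ (Set.mem_range_self s))
  · convert hu.2 i

namespace OneRoundAlgorithm

variable (A : q.OneRoundAlgorithm n p) (F : ∀ j, Finset (Relation (q.arity j) n))

/-- The tuples of `S_j` that machine `c` knows after it has received the message about `S_j = S`,
given that `S_j ∈ F j`. -/
def known (c : Fin p) (j : Fin l) (S : Relation (q.arity j) n) : Relation (q.arity j) n :=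
  revealed (F j) (A.msg c j) (A.msg c j S)

variable {A F}

/-- If one relation is replaced by another one with the same message, then machine `c` still outputs
the tuple, so the tuple must be an answer of the new database as well. -/
lemma IsSoundOn.mem_known (hA : A.IsSoundOn (Fintype.piFinset F)) {I : q.Database n}
    (hI : I ∈ Fintype.piFinset F) {c : Fin p} {a : Fin k → Fin n}
    (ha : a ∈ A.out c fun j => A.msg c j (I j)) (j : Fin l) :
    a ∘ q.atom j ∈ A.known F c j (I j) := by
  refine mem_revealed.2 fun S hS hmsg => ?_
  have hI' : Function.update I j S ∈ Fintype.piFinset F := by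
    simp only [Fintype.mem_piFinset] at hI ⊢
    exact (Function.forall_update_iff I fun i R => R ∈ F i).2 ⟨hS, fun i _ => hI i⟩
  have hmsgs : (fun i => A.msg c i (Function.update I j S i)) = fun i => A.msg c i (I i) := by
    funext i
    rcases eq_or_ne i j with rfl | hij
    · simpa using hmsg
    · simp [hij]
  have ha' : a ∈ A.output (Function.update I j S) :=
    mem_biUnion.2 ⟨c, mem_univ c, by rwa [hmsgs]⟩
  simpa using mem_eval.1 (hA _ hI' ha') j

lemma one_le_sum_prod_revealProb (hF : ∀ j b, ({S ∈ F j | b ∈ S}).Nonempty)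
    (hA : ∀ I ∈ Fintype.piFinset F, A.output I = q.eval I) (a : Fin k → Fin n) :
    1 ≤ ∑ c, ∏ j, revealProb (F j) (A.msg c j) (a ∘ q.atom j) := by
  let G (j : Fin l) : Finset (Relation (q.arity j) n) := {S ∈ F j | a ∘ q.atom j ∈ S}
  have hone (I) (hI : I ∈ Fintype.piFinset G) :
      1 ≤ ∑ c, ∏ j, if a ∘ q.atom j ∈ A.known F c j (I j) then (1 : ℝ) else 0 := by
    have hG (j : Fin l) := mem_filter.1 (Fintype.mem_piFinset.1 hI j)
    have hIF : I ∈ Fintype.piFinset F := Fintype.mem_piFinset.2 fun j => (hG j).1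
    have ha : a ∈ A.output I := hA I hIF ▸ mem_eval.2 fun j => (hG j).2
    obtain ⟨c, -, hc⟩ := mem_biUnion.1 ha
    have hsound : A.IsSoundOn (Fintype.piFinset F) := fun I hI => (hA I hI).subset
    refine le_trans ?_ (single_le_sum (fun c _ => prod_nonneg fun j _ => ?_) (mem_univ c))
    · simp [hsound.mem_known hIF hc]
    · positivity
  calc (1 : ℝ) ≤ 𝔼 I ∈ Fintype.piFinset G, ∑ c, ∏ j,
        if a ∘ q.atom j ∈ A.known F c j (I j) then (1 : ℝ) else 0 :=
        le_expect (Fintype.piFinset_nonempty.2 fun j => hF j _) hone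
    _ = ∑ c, ∏ j, revealProb (F j) (A.msg c j) (a ∘ q.atom j) := by
        rw [expect_sum_comm]
        exact sum_congr rfl fun c _ => expect_piFinset_prod G fun j S =>
          if a ∘ q.atom j ∈ A.known F c j S then (1 : ℝ) else 0

theorem one_le_sum_prod_expect_card_known [NeZero n] {u : Fin l → ℝ}
    (hu : q.IsFractionalEdgePacking u) (hm : 0 < m) (hF : ∀ j, (F j).Nonempty)
    (hdesign : ∀ j, IsOneDesign (F j) m)
    (hA : ∀ I ∈ Fintype.piFinset F, A.output I = q.eval I) :
    1 ≤ ∑ c, ∏ j, ((𝔼 S ∈ F j, (#(A.known F c j S) : ℝ)) / m) ^ u j := by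
  let v (c : Fin p) (j : Fin l) := revealProb (F j) (A.msg c j)
  have hv₀ (c j b) : 0 ≤ v c j b := revealProb_nonneg ..
  have hone (a : Fin k → Fin n) : 1 ≤ ∑ c, ∏ j, v c j (a ∘ q.atom j) ^ u j := by
    refine (one_le_sum_prod_revealProb (fun j => (hdesign j).filter_mem_nonempty (hF j) hm) hA
      a).trans ?_
    gcongr with c _ j _
    · exact fun j _ => hv₀ c j _
    · exact Real.self_le_rpow_of_le_one (hv₀ c j _) (revealProb_le_one ..) (hu.le_one j)
  calc (1 : ℝ) ≤ 𝔼 a : Fin k → Fin n, ∑ c, ∏ j, v c j (a ∘ q.atom j) ^ u j :=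
        le_expect univ_nonempty fun a _ => hone a
    _ = ∑ c, 𝔼 a : Fin k → Fin n, ∏ j, v c j (a ∘ q.atom j) ^ u j := expect_sum_comm ..
    _ ≤ ∑ c, ∏ j, (𝔼 b, v c j b) ^ u j := by
        gcongr with c
        exact hu.expect_prod_rpow_le (hv₀ c)
    _ = ∑ c, ∏ j, ((𝔼 S ∈ F j, (#(A.known F c j S) : ℝ)) / m) ^ u j := by
        simp only [v, (hdesign _).expect_revealProb, known]

lemma exists_bits_eq_sum_sup (hF : ∀ j, (F j).Nonempty) (c : Fin p) :
    ∃ I ∈ Fintype.piFinset F, A.bits I c = ∑ j, (F j).sup fun S => (A.msg c j S).length := by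
  choose I hI hmax using fun j => exists_mem_eq_sup (F j) (hF j) fun S => (A.msg c j S).length
  exact ⟨I, Fintype.mem_piFinset.2 hI, sum_congr rfl fun j _ => (hmax j).symm⟩

lemma bits_le_load_mul {D : Finset (q.Database n)} {I : q.Database n} (hI : I ∈ D)
    {w : Fin p → ℝ≥0} {c : Fin p} (hw : 0 < w c) :
    (A.bits I c : ℝ≥0) ≤ A.load D (linearCost w) * w c :=
  (div_le_iff₀ hw).1 <|
    (le_sup (f := fun c => linearCost w c (A.bits I c)) (mem_univ c)).trans
      (le_sup (f := fun I => univ.sup fun c => linearCost w c (A.bits I c)) hI)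

lemma sup_length_le_load_mul (hF : ∀ j, (F j).Nonempty) {w : Fin p → ℝ≥0} {c : Fin p}
    (hw : 0 < w c) (j : Fin l) :
    (((F j).sup fun S => (A.msg c j S).length : ℕ) : ℝ≥0) ≤
      A.load (Fintype.piFinset F) (linearCost w) * w c := by
  obtain ⟨I, hI, hbits⟩ := exists_bits_eq_sum_sup (A := A) hF c
  refine (Nat.cast_le.2 ?_).trans (bits_le_load_mul hI hw)
  rw [hbits]
  exact single_le_sum (f := fun j => (F j).sup fun S => (A.msg c j S).length)
    (fun _ _ => Nat.zero_le _) (mem_univ j)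

lemma logb_mul_expect_card_known_le {β : ℝ} (hβ : 0 < β) (hF : ∀ j, (F j).Nonempty)
    {w : Fin p → ℝ≥0} {c : Fin p} (hw : 0 < w c) {j : Fin l} (hspread : IsSpread (F j) β) :
    Real.logb 3 β⁻¹ * 𝔼 S ∈ F j, (#(A.known F c j S) : ℝ) ≤
      A.load (Fintype.piFinset F) (linearCost w) * w c := by
  have h := hspread.logb_mul_expect_card_revealed_le hβ (hF j) (f := A.msg c j)
    fun S hS => le_sup (f := fun S => (A.msg c j S).length) hS
  rw [Fintype.card_bool, Nat.cast_ofNat, show (2 : ℝ) + 1 = 3 by norm_num] at h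
  exact h.trans (by exact_mod_cast sup_length_le_load_mul hF hw j)

theorem mul_lowerLoad_le_load [NeZero n] {u : Fin l → ℝ} (hu : q.IsFractionalEdgePacking u)
    (hu₀ : 0 < ∑ j, u j) (hm : 0 < m) (hF : ∀ j, (F j).Nonempty)
    (hdesign : ∀ j, IsOneDesign (F j) m) {β : ℝ} (hβ : 0 < β) (hspread : ∀ j, IsSpread (F j) β)
    (hA : ∀ I ∈ Fintype.piFinset F, A.output I = q.eval I) {w : Fin p → ℝ≥0}
    (hw : ∀ c, 0 < w c) :
    (Real.logb 3 β⁻¹).toNNReal * lowerLoad m w (∑ j, u j) ≤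
      A.load (Fintype.piFinset F) (linearCost w) := by
  have hK (c : Fin p) (j : Fin l) : 0 ≤ 𝔼 S ∈ F j, (#(A.known F c j S) : ℝ) :=
    expect_nonneg fun _ _ => Nat.cast_nonneg _
  refine mul_lowerLoad_le_of_one_le_sum_prod hu.1 hu₀ hK
    (one_le_sum_prod_expect_card_known hu hm hF hdesign hA) fun c j => ?_
  rw [Real.coe_toNNReal', max_mul_of_nonneg _ _ (hK c j), zero_mul]
  exact max_le (logb_mul_expect_card_known_le hβ hF (hw c) (hspread j)) (by positivity)

end OneRoundAlgorithm

end ConjunctiveQuery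

lemma ae_eq_of_ae_le_of_le_integral {Ω : Type*} [MeasurableSpace Ω] {P : Measure Ω}
    [IsProbabilityMeasure P] {f : Ω → ℝ} {a : ℝ} (ha : 0 < a) (hf : ∀ᵐ ω ∂P, f ω ≤ a)
    (h : a ≤ ∫ ω, f ω ∂P) : ∀ᵐ ω ∂P, f ω = a := by
  have hint : Integrable f P := Integrable.of_integral_ne_zero (ha.trans_le h).ne'
  refine (integral_eq_iff_of_ae_le hint (integrable_const a) hf).1 (le_antisymm ?_ ?_)
  · exact integral_mono_ae hint (integrable_const a) hf
  · simpa using h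

lemma eq_of_subset_of_expect_card_eq {ι α : Type*} {D : Finset ι} {X Y : ι → Finset α}
    (hXY : ∀ i ∈ D, X i ⊆ Y i) (h : 𝔼 i ∈ D, (#(X i) : ℝ) = 𝔼 i ∈ D, (#(Y i) : ℝ)) :
    ∀ i ∈ D, X i = Y i := by
  intro i hi
  by_contra hne
  refine h.not_lt (expect_lt_expect (fun i hi => Nat.cast_le.2 (card_le_card (hXY i hi)))
    ⟨i, hi, Nat.cast_lt.2 (card_lt_card ((hXY i hi).ssubset_of_ne hne))⟩)

namespace ConjunctiveQuery

variable {k l : ℕ} {q : ConjunctiveQuery k l} {n p m : ℕ}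

lemma ae_output_eq_eval {D : Finset (q.Database n)} (hD : ∃ I ∈ D, (q.eval I).Nonempty)
    {Ω : Type*} [MeasurableSpace Ω] {P : Measure Ω} [IsProbabilityMeasure P]
    {A : Ω → q.OneRoundAlgorithm n p} (hsound : ∀ᵐ ω ∂P, (A ω).IsSoundOn D)
    (hcomplete : 𝔼 I ∈ D, (#(q.eval I) : ℝ) ≤ ∫ ω, 𝔼 I ∈ D, (#((A ω).output I) : ℝ) ∂P) :
    ∀ᵐ ω ∂P, ∀ I ∈ D, (A ω).output I = q.eval I := by
  have hpos : 0 < 𝔼 I ∈ D, (#(q.eval I) : ℝ) := by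
    obtain ⟨I, hI, hne⟩ := hD
    exact expect_pos' (fun _ _ => Nat.cast_nonneg _) ⟨I, hI, Nat.cast_pos.2 hne.card_pos⟩
  have hle : ∀ᵐ ω ∂P, 𝔼 I ∈ D, (#((A ω).output I) : ℝ) ≤ 𝔼 I ∈ D, (#(q.eval I) : ℝ) := by
    filter_upwards [hsound] with ω hω
    exact expect_le_expect fun I hI => Nat.cast_le.2 (card_le_card (hω I hI))
  filter_upwards [hsound, ae_eq_of_ae_le_of_le_integral hpos hle hcomplete] with ω hω heq
  exact eq_of_subset_of_expect_card_eq hω heq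

section OneDesign

variable {F : ∀ j, Finset (Relation (q.arity j) n)}

lemma exists_mem_piFinset_eval_nonempty [NeZero n] (hm : 0 < m) (hF : ∀ j, (F j).Nonempty)
    (hdesign : ∀ j, IsOneDesign (F j) m) :
    ∃ I ∈ Fintype.piFinset F, (q.eval I).Nonempty := by
  choose I hI using fun j => (hdesign j).filter_mem_nonempty (hF j) hm 0
  simp only [mem_filter] at hI
  exact ⟨I, Fintype.mem_piFinset.2 fun j => (hI j).1, 0, mem_eval.2 fun j => (hI j).2⟩

lemma neZero_of_isOneDesign (hm : 0 < m) {j : Fin l} (hF : (F j).Nonempty)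
    (hdesign : IsOneDesign (F j) m) : NeZero n := by
  obtain ⟨S, hS⟩ := hF
  obtain ⟨a, -⟩ := card_pos.1 (hm.trans_eq (hdesign.card_eq S hS).symm)
  exact ⟨(a ⟨0, q.arity_pos j⟩).pos.ne'⟩

theorem ae_mul_lowerLoad_le_load {u : Fin l → ℝ} (hu : q.IsFractionalEdgePacking u)
    (hu₀ : 0 < ∑ j, u j) (hF : ∀ j, (F j).Nonempty) (hdesign : ∀ j, IsOneDesign (F j) m)
    {β : ℝ} (hβ : 0 < β) (hspread : ∀ j, IsSpread (F j) β) {w : Fin p → ℝ≥0}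
    (hw : ∀ c, 0 < w c) {Ω : Type*} [MeasurableSpace Ω] {P : Measure Ω} [IsProbabilityMeasure P]
    {A : Ω → q.OneRoundAlgorithm n p} (hsound : ∀ᵐ ω ∂P, (A ω).IsSoundOn (Fintype.piFinset F))
    (hcomplete : 𝔼 I ∈ Fintype.piFinset F, (#(q.eval I) : ℝ) ≤
      ∫ ω, 𝔼 I ∈ Fintype.piFinset F, (#((A ω).output I) : ℝ) ∂P) :
    ∀ᵐ ω ∂P, (Real.logb 3 β⁻¹).toNNReal * lowerLoad m w (∑ j, u j) ≤
      (A ω).load (Fintype.piFinset F) (linearCost w) := by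
  rcases m.eq_zero_or_pos with rfl | hm
  · simp [lowerLoad]
  obtain ⟨j, -, -⟩ := exists_ne_zero_of_sum_ne_zero hu₀.ne'
  have := neZero_of_isOneDesign hm (hF j) (hdesign j)
  filter_upwards [ae_output_eq_eval (exists_mem_piFinset_eval_nonempty hm hF hdesign) hsound
    hcomplete] with ω hω
  exact OneRoundAlgorithm.mul_lowerLoad_le_load hu hu₀ hm hF hdesign hβ hspread hω hw

end OneDesign

lemma matchingDatabases_eq_piFinset (q : ConjunctiveQuery k l) (n m : ℕ) :
    q.matchingDatabases n m = Fintype.piFinset fun j => matchings (q.arity j) n m := by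
  ext I
  simp [matchingDatabases, mem_matchings]

lemma denseDatabases_eq_piFinset (q : ConjunctiveQuery k l) {θ : ℝ}
    (hm : ∀ j, m = ⌊θ * (n : ℝ) ^ q.arity j⌋₊) :
    q.denseDatabases θ n = Fintype.piFinset fun _ => powersetCard m univ := by
  ext I
  simp [denseDatabases, ← hm]

end ConjunctiveQuery

/-- The randomness of the algorithm is a probability space `(Ω, P)` of coins shared by everybody
(a deterministic algorithm is the case of a one-point `Ω`). -/
theorem mainTheorem1 (θ : ℝ) (hθ₀ : 0 < θ) (hθ₁ : θ < 1) :
    ∃ C : ℝ≥0, 0 < C ∧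
      ∀ (k l : ℕ) (q : ConjunctiveQuery k l) (u : Fin l → ℝ),
        q.IsFractionalEdgePacking u → 0 < ∑ j, u j →
      ∀ (n m p : ℕ) (w : Fin p → ℝ≥0), (∀ c, 0 < w c) →
      ∀ (Ω : Type*) [MeasurableSpace Ω] (P : Measure Ω) [IsProbabilityMeasure P]
        (A : Ω → q.OneRoundAlgorithm n p),
        -- matching databases
        (2 ≤ n → m ≤ n → (∀ j, q.arity j = 1 → (m : ℝ) ≤ θ * n) →
          (∀ᵐ ω ∂P, (A ω).IsSoundOn (q.matchingDatabases n m)) →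
          𝔼 I ∈ q.matchingDatabases n m, ((q.eval I).card : ℝ) ≤
            ∫ ω, 𝔼 I ∈ q.matchingDatabases n m, (((A ω).output I).card : ℝ) ∂P →
          ∀ᵐ ω ∂P, C * lowerLoad m w (∑ j, u j) ≤
            (A ω).load (q.matchingDatabases n m) (linearCost w)) ∧
        -- dense databases
        ((∀ j, m = ⌊θ * (n : ℝ) ^ q.arity j⌋₊) →
          (∀ᵐ ω ∂P, (A ω).IsSoundOn (q.denseDatabases θ n)) →
          𝔼 I ∈ q.denseDatabases θ n, ((q.eval I).card : ℝ) ≤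
            ∫ ω, 𝔼 I ∈ q.denseDatabases θ n, (((A ω).output I).card : ℝ) ∂P →
          ∀ᵐ ω ∂P, C * lowerLoad m w (∑ j, u j) ≤
            (A ω).load (q.denseDatabases θ n) (linearCost w)) := by
  have hβ₀ : 0 < max θ (3 / 4) := lt_max_of_lt_left hθ₀
  have hβ₁ : max θ (3 / 4) < 1 := max_lt hθ₁ (by norm_num)
  refine ⟨(Real.logb 3 (max θ (3 / 4))⁻¹).toNNReal,
    Real.toNNReal_pos.2 (Real.logb_pos (by norm_num) ((one_lt_inv₀ hβ₀).2 hβ₁)), ?_⟩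
  intro k l q u hu hu₀ n m p w hw Ω _ P _ A
  refine ⟨fun hn hmn hunary hsound hcomplete => ?_, fun hm hsound hcomplete => ?_⟩
  · rw [q.matchingDatabases_eq_piFinset] at hsound hcomplete ⊢
    exact ConjunctiveQuery.ae_mul_lowerLoad_le_load hu hu₀
      (fun j => matchings_nonempty (q.arity_pos j) hmn) (fun j => isOneDesign_matchings _ n m) hβ₀
      (fun j => isSpread_matchings_max (q.arity_pos j) hn hθ₀.le hθ₁.le (hunary j)) hw hsound
      hcomplete
  · rw [q.denseDatabases_eq_piFinset hm] at hsound hcomplete ⊢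
    have hle (j : Fin l) : (m : ℝ) ≤ θ * Fintype.card (Fin (q.arity j) → Fin n) := by
      simpa [hm j] using Nat.floor_le (by positivity : 0 ≤ θ * (n : ℝ) ^ q.arity j)
    exact ConjunctiveQuery.ae_mul_lowerLoad_le_load hu hu₀
      (fun j => powersetCard_nonempty.2 <| Nat.cast_le.1 <|
        (hle j).trans (mul_le_of_le_one_left (Nat.cast_nonneg _) hθ₁.le))
      (fun j => isOneDesign_powersetCard m) hβ₀
      (fun j => (isSpread_powersetCard hθ₀.le hθ₁.le (hle j)).mono hθ₀.le (le_max_left ..)) hw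
      hsound hcomplete
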